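/- Let $CS^d_n$ be the set of $d$-tuples $S=(S^1,\dots,S^d)$ of pairwise-commuting self-adjoint complex $n\times n$ matrices, with $\|S\|=\max_r\|S^r\|$. Each $S\in CS^d_n$ can be written $S^r=U\,\mathrm{diag}(x_1^r,\dots,x_n^r)\,U^*$ ($1\le r\le d$) with one unitary $U$; its joint spectrum is $\sigma(S)=\{x_i=(x_i^1,\dots,x_i^d):1\le i\le n\}\subset\mathbb R^d$. A function $f:\Omega\to\mathbb R$ with $\Omega\subseteq\mathbb R^d$ induces the matrix function $F(S)=U\,\mathrm{diag}(f(x_1),\dots,f(x_n))\,U^*$ for $S \in CS^d_n$ with $\sigma(S)\subset\Omega$; neither $\sigma(S)$ nor $F(S)$ depends on the choice of $U$. Intervals have more than one point and may be open, closed or half-open, bounded or not; at an endpoint belonging to the interval, derivatives are one-sided. **Theorem.** Let $S(t)$ be a $C^1$ curve in $CS^d_n$ defined on an interval $I$, let $\Omega\subseteq\mathbb R^d$ be open with $\sigma(S(t))\subset\Omega$ for all $t\in I$, and let $f\in C^1(\Omega,\mathbb R)$. Then: (i) $\frac{d}{dt}F(S(t))\big|_{t=t^*}$ exists for every $t^*\in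 I$. (ii) Let $t^*\in I$. If $T(t)$ is another $C^1$ curve in $CS^d_n$, defined on an interval $J$ containing $0$, with $T(0)=S(t^*)$ and $T'(0)=S'(t^*)$, then $F(T(t))$, which is defined for all $t \in J$ near $0$, is differentiable at $t=0$ and $$\tfrac{d}{dt}F(T(t))\big|_{t=0}=\tfrac{d}{dt}F(S(t))\big|_{t=t^*}.$$ -/

import Mathlib

/- Matrices carry the Euclidean operator norm, and `d`-tuples of matrices the maximum of the
operator norms of their components. -/
open scoped Matrix.Norms.L2Operator

namespace InducedMatrixFunction

/-- `d`-tuples of complex `n × n` matrices. -/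
abbrev MatTuple (d n : ℕ) : Type := Fin d → Matrix (Fin n) (Fin n) ℂ

/-- The set of `d`-tuples of pairwise-commuting self-adjoint `n × n` matrices. -/
def CS (d n : ℕ) : Set (MatTuple d n) :=
  {S | (∀ r, (S r).IsHermitian) ∧ ∀ r s, S r * S s = S s * S r}

/-- The unitary matrix `U` diagonalizes every `S r`, the `i`-th diagonal entry being the `r`-th
coordinate of `x i`. -/
structure IsJointDiag {d n : ℕ} (S : MatTuple d n) (U : Matrix (Fin n) (Fin n) ℂ)
    (x : Fin n → Fin d → ℝ) : Prop where
  unitary : U ∈ Matrix.unitaryGroup (Fin n) ℂ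
  eq_conj : ∀ r, S r = U * Matrix.diagonal (fun i => (x i r : ℂ)) * star U

/-- The joint spectrum: the set of joint eigenvalues `x i` in a joint diagonalization. It does not
depend on the diagonalization, see `jointSpectrum_eq_range`. -/
def jointSpectrum {d n : ℕ} (S : MatTuple d n) : Set (Fin d → ℝ) :=
  {p | ∃ U x, IsJointDiag S U x ∧ p ∈ Set.range x}

open Classical in
/-- The matrix function `F` induced by `f`: `F(S) = U diag(f(x₁), …, f(xₙ)) U*`, where `U` is a
unitary matrix that diagonalizes `S` with joint eigenvalues `x₁, …, xₙ`. Such a `U` exists on `CS`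
(`exists_isJointDiag`) and the value does not depend on it (`matrixFunction_eq`). -/
noncomputable def matrixFunction {d n : ℕ} (f : (Fin d → ℝ) → ℝ) (S : MatTuple d n) :
    Matrix (Fin n) (Fin n) ℂ :=
  if h : ∃ q : Matrix (Fin n) (Fin n) ℂ × (Fin n → Fin d → ℝ), IsJointDiag S q.1 q.2 then
    h.choose.1 * Matrix.diagonal (fun i => (f (h.choose.2 i) : ℂ)) * star h.choose.1
  else 0

theorem exists_isJointDiag {d n : ℕ} {S : MatTuple d n} (hS : S ∈ CS d n) :
    ∃ U x, IsJointDiag S U x := by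
  classical
  let T : Fin d → Module.End ℂ (EuclideanSpace ℂ (Fin n)) := fun r => Matrix.toEuclideanLin (S r)
  have hT : ∀ r, (T r).IsSymmetric := fun r => Matrix.isSymmetric_toEuclideanLin_iff.2 (hS.1 r)
  have hTa : ∀ r v, T r v = WithLp.toLp 2 ((S r).mulVec v.ofLp) := fun r v => rfl
  have hC : Pairwise (Function.onFun Commute T) := by
    intro r s _
    refine LinearMap.ext fun v => ?_
    simp only [Module.End.mul_apply, hTa, Matrix.mulVec_mulVec, hS.2 r s]
  let V : (Fin d → ℂ) → Submodule ℂ (EuclideanSpace ℂ (Fin n)) :=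
    fun α => ⨅ j, (T j).eigenspace (α j)
  have hV : OrthogonalFamily ℂ (fun α => V α) fun α => (V α).subtypeₗᵢ :=
    LinearMap.IsSymmetric.orthogonalFamily_iInf_eigenspaces hT
  have hI : DirectSum.IsInternal V :=
    LinearMap.IsSymmetric.directSum_isInternal_of_pairwise_commute hT hC
  have : Fintype {α // V α ≠ ⊥} :=
    (WellFoundedGT.finite_ne_bot_of_iSupIndep hV.independent).fintype
  have hI' : DirectSum.IsInternal fun α : {α // V α ≠ ⊥} => V α :=
    DirectSum.isInternal_ne_bot_iff.2 hI
  have hV' : OrthogonalFamily ℂ (fun α : {α // V α ≠ ⊥} => V α) fun α => (V α).subtypeₗᵢ :=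
    hV.comp Subtype.coe_injective
  have hn : Module.finrank ℂ (EuclideanSpace ℂ (Fin n)) = n := by simp
  let b := hI'.subordinateOrthonormalBasis hn hV'
  let α : Fin n → Fin d → ℂ := fun i => (hI'.subordinateOrthonormalBasisIndex hn i hV').1
  have hb : ∀ i r, T r (b i) = α i r • b i := fun i r => by
    have h := hI'.subordinateOrthonormalBasis_subordinate hn i hV'
    exact Module.End.mem_eigenspace_iff.1 ((Submodule.mem_iInf _).1 h r)
  have hα : ∀ i r, ((α i r).re : ℂ) = α i r := fun i r => by
    refine Complex.conj_eq_iff_re.1 ((hT r).conj_eigenvalue_eq_self ?_)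
    exact Module.End.hasEigenvalue_of_hasEigenvector
      ⟨Module.End.mem_eigenspace_iff.2 (hb i r), b.orthonormal.ne_zero i⟩
  let U : Matrix (Fin n) (Fin n) ℂ := Matrix.of fun k i => b i k
  have hU : star U * U = 1 := by
    ext i j
    have h := orthonormal_iff_ite.1 b.orthonormal i j
    rw [PiLp.inner_apply] at h
    simpa [Matrix.mul_apply, U, Matrix.one_apply, mul_comm] using h
  have hU' : U * star U = 1 := mul_eq_one_comm.1 hU
  refine ⟨U, fun i r => (α i r).re, ⟨Matrix.mem_unitaryGroup_iff.2 hU', fun r => ?_⟩⟩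
  have h : S r * U = U * Matrix.diagonal (fun i => ((α i r).re : ℂ)) := by
    ext k i
    have h := congrArg (fun v : EuclideanSpace ℂ (Fin n) => v k) (hb i r)
    rw [Matrix.mul_diagonal, hα]
    simpa [hTa, Matrix.mulVec, dotProduct, Matrix.mul_apply, U, mul_comm] using h
  rw [← h, mul_assoc, hU', mul_one]

theorem IsJointDiag.intertwine {d n : ℕ} {S : MatTuple d n} {U V : Matrix (Fin n) (Fin n) ℂ}
    {x y : Fin n → Fin d → ℝ} (hU : IsJointDiag S U x) (hV : IsJointDiag S V y) (i j : Fin n) :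
    (star V * U) i j = 0 ∨ y i = x j := by
  by_contra! h
  refine h.2 (funext fun r => ?_)
  have hU1 := Matrix.mem_unitaryGroup_iff'.1 hU.unitary
  have hV1 := Matrix.mem_unitaryGroup_iff'.1 hV.unitary
  have e : star V * (S r * U) = (star V * S r) * U := (mul_assoc _ _ _).symm
  nth_rewrite 1 [hU.eq_conj r] at e
  rw [hV.eq_conj r, mul_assoc _ (star U), hU1, mul_one, ← mul_assoc, ← mul_assoc (star V),
    ← mul_assoc (star V), hV1, one_mul, mul_assoc _ (star V)] at e
  have e' := congrFun (congrFun e i) j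
  rw [Matrix.mul_diagonal, Matrix.diagonal_mul, mul_comm] at e'
  exact_mod_cast (mul_right_cancel₀ h.1 e').symm

theorem jointSpectrum_eq_range {d n : ℕ} {S : MatTuple d n} {U : Matrix (Fin n) (Fin n) ℂ}
    {x : Fin n → Fin d → ℝ} (hU : IsJointDiag S U x) : jointSpectrum S = Set.range x := by
  refine Set.Subset.antisymm ?_ fun p hp => ⟨U, x, hU, hp⟩
  rintro _ ⟨V, y, hV, j, rfl⟩
  by_contra hj
  have h0 : ∀ i, (star U * V) i j = 0 := fun i =>
    (hV.intertwine hU i j).resolve_right fun h => hj ⟨i, h⟩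
  have h1 : star (star U * V) * (star U * V) = 1 := by
    rw [star_mul, star_star, mul_assoc, ← mul_assoc U, Matrix.mem_unitaryGroup_iff.1 hU.unitary,
      one_mul, Matrix.mem_unitaryGroup_iff'.1 hV.unitary]
  have h2 := congrFun (congrFun h1 j) j
  rw [Matrix.mul_apply] at h2
  simp [h0] at h2

theorem matrixFunction_eq {d n : ℕ} (f : (Fin d → ℝ) → ℝ) {S : MatTuple d n}
    {U : Matrix (Fin n) (Fin n) ℂ} {x : Fin n → Fin d → ℝ} (hU : IsJointDiag S U x) :
    matrixFunction f S = U * Matrix.diagonal (fun i => (f (x i) : ℂ)) * star U := by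
  have hex : ∃ q : Matrix (Fin n) (Fin n) ℂ × (Fin n → Fin d → ℝ), IsJointDiag S q.1 q.2 :=
    ⟨(U, x), hU⟩
  rw [matrixFunction, dif_pos hex]
  have hV := hex.choose_spec
  generalize hex.choose = q at hV
  obtain ⟨V, y⟩ := q
  dsimp only at hV ⊢
  have h : Matrix.diagonal (fun i => (f (y i) : ℂ)) * (star V * U)
      = (star V * U) * Matrix.diagonal (fun i => (f (x i) : ℂ)) := by
    ext i j
    rw [Matrix.mul_diagonal, Matrix.diagonal_mul]
    rcases hU.intertwine hV i j with h | h
    · simp [h]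
    · rw [h, mul_comm]
  have hU1 := Matrix.mem_unitaryGroup_iff.1 hU.unitary
  have hV1 := Matrix.mem_unitaryGroup_iff.1 hV.unitary
  calc V * Matrix.diagonal (fun i => (f (y i) : ℂ)) * star V
      = V * (Matrix.diagonal (fun i => (f (y i) : ℂ)) * (star V * U)) * star U := by
        simp only [mul_assoc, hU1, mul_one]
    _ = (V * star V) * U * Matrix.diagonal (fun i => (f (x i) : ℂ)) * star U := by
        rw [h]; simp only [mul_assoc]
    _ = _ := by rw [hV1, one_mul]

end InducedMatrixFunction

open InducedMatrixFunction

/-!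
The matrix function `F` is differentiable, relative to the set `CS d n`, at every tuple `A` such
that `f` is differentiable at the joint eigenvalues of `A` (`exists_hasFDerivWithinAt`). Both parts
of the theorem then follow from the chain rule, since the derivative along a curve depends only on
its position and velocity.

To differentiate `F` at `A`, choose by Hermite interpolation a polynomial `p` that agrees with `f`
to first order at each joint eigenvalue of `A` (`exists_hermite_interpolation`). The matrix function
of a polynomial is a polynomial in the matrices `S r`, hence differentiable. The remainder
`g = f - p` and its derivative vanish at the joint eigenvalues of `A`. As each joint eigenvalue of
`S` has distance at most `n * ‖S - A‖` from a joint eigenvalue of `A`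
(`IsJointDiag.exists_eigenvalue_near`), the norm of `G(S)`, which is the maximum of `|g|` over the
joint spectrum of `S`, is `o(‖S - A‖)` (`hasFDerivWithinAt_zero_of_eigenvalues`).
-/

namespace InducedMatrixFunction

/-! ### Functions with a differentiable matrix extension -/

/-- The matrix function induced by `p` is the restriction of an everywhere differentiable map on
all tuples of matrices, commuting or not. Polynomials `p` have this property. -/
def HasDifferentiableExtension (d n : ℕ) (p : (Fin d → ℝ) → ℝ) : Prop :=
  ∃ Φ : MatTuple d n → Matrix (Fin n) (Fin n) ℂ, Differentiable ℝ Φ ∧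
    ∀ S U x, IsJointDiag S U x →
      Φ S = U * Matrix.diagonal (fun i => (p (x i) : ℂ)) * star U

namespace HasDifferentiableExtension

variable {d n : ℕ} {p q : (Fin d → ℝ) → ℝ}

theorem const (c : ℝ) : HasDifferentiableExtension d n (fun _ => c) := by
  refine ⟨fun _ => (c : ℂ) • 1, differentiable_const _, fun S U x h => ?_⟩
  have h1 : Matrix.diagonal (fun _ : Fin n => (c : ℂ)) = (c : ℂ) • 1 := by
    rw [Matrix.smul_one_eq_diagonal]
  rw [h1, mul_smul_comm, mul_one, smul_mul_assoc, Matrix.mem_unitaryGroup_iff.1 h.unitary]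

theorem coord (r : Fin d) : HasDifferentiableExtension d n (fun y => y r) :=
  ⟨fun S => S r, differentiable_apply r, fun _ _ _ h => h.eq_conj r⟩

theorem add (hp : HasDifferentiableExtension d n p) (hq : HasDifferentiableExtension d n q) :
    HasDifferentiableExtension d n (fun y => p y + q y) := by
  obtain ⟨Φ, hΦ, hp⟩ := hp
  obtain ⟨Ψ, hΨ, hq⟩ := hq
  refine ⟨fun S => Φ S + Ψ S, hΦ.add hΨ, fun S U x h => ?_⟩
  beta_reduce
  rw [hp S U x h, hq S U x h, ← add_mul, ← mul_add, Matrix.diagonal_add]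
  simp only [Complex.ofReal_add]

theorem mul (hp : HasDifferentiableExtension d n p) (hq : HasDifferentiableExtension d n q) :
    HasDifferentiableExtension d n (fun y => p y * q y) := by
  obtain ⟨Φ, hΦ, hp⟩ := hp
  obtain ⟨Ψ, hΨ, hq⟩ := hq
  refine ⟨fun S => Φ S * Ψ S, hΦ.mul hΨ, fun S U x h => ?_⟩
  have hU := Matrix.mem_unitaryGroup_iff'.1 h.unitary
  beta_reduce
  rw [hp S U x h, hq S U x h]
  simp only [Complex.ofReal_mul, ← Matrix.diagonal_mul_diagonal, mul_assoc]
  rw [← mul_assoc (star U) U, hU, one_mul]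

theorem sum {ι : Type*} (s : Finset ι) {p : ι → (Fin d → ℝ) → ℝ}
    (hp : ∀ i ∈ s, HasDifferentiableExtension d n (p i)) :
    HasDifferentiableExtension d n (fun y => ∑ i ∈ s, p i y) := by
  classical
  induction s using Finset.induction_on with
  | empty => simpa using const 0
  | insert a s ha ih =>
    simp only [Finset.sum_insert ha]
    exact (hp a (by simp)).add (ih fun i hi => hp i (by simp [hi]))

theorem continuousLinearMap (l : (Fin d → ℝ) →L[ℝ] ℝ) : HasDifferentiableExtension d n l := by
  have h : (l : (Fin d → ℝ) → ℝ) = 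
      fun y => ∑ r, y r * l (fun s => if r = s then 1 else 0) :=
    funext fun y => LinearMap.pi_apply_eq_sum_univ (l : (Fin d → ℝ) →ₗ[ℝ] ℝ) y
  rw [h]
  exact sum _ fun r _ => (coord r).mul (const _)

end HasDifferentiableExtension

/-! ### Hermite interpolation -/

/-- A polynomial vanishing to second order on a finite set and nonzero at a given point outside. -/
theorem exists_vanishing_to_second_order {d : ℕ} (n : ℕ) (X : Finset (Fin d → ℝ))
    (z : Fin d → ℝ) (hz : z ∉ X) :
    ∃ w : (Fin d → ℝ) → ℝ, HasDifferentiableExtension d n w ∧ Differentiable ℝ w ∧ w z ≠ 0 ∧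
      ∀ x ∈ X, w x = 0 ∧ HasFDerivAt w (0 : (Fin d → ℝ) →L[ℝ] ℝ) x := by
  classical
  induction X using Finset.induction_on with
  | empty => exact ⟨fun _ => 1, .const 1, differentiable_const _, one_ne_zero, by simp⟩
  | insert a X ha ih =>
    rw [Finset.mem_insert, not_or] at hz
    obtain ⟨w, hw, hwd, hwz, hwX⟩ := ih hz.2
    obtain ⟨r, hr⟩ := Function.ne_iff.1 hz.1
    -- One coordinate separating `a` from `z` suffices for the new factor.
    let v : (Fin d → ℝ) → ℝ := fun y => (y r + -a r) * (y r + -a r)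
    have hv : HasDifferentiableExtension d n v :=
      ((HasDifferentiableExtension.coord r).add (.const _)).mul
        ((HasDifferentiableExtension.coord r).add (.const _))
    have hu : Differentiable ℝ fun y : Fin d → ℝ => y r + -a r := by fun_prop
    have hvd : Differentiable ℝ v := hu.mul hu
    refine ⟨fun y => w y * v y, hw.mul hv, hwd.mul hvd, ?_, ?_⟩
    · have : z r + -a r ≠ 0 := by rwa [← sub_eq_add_neg, sub_ne_zero]
      exact mul_ne_zero hwz (mul_ne_zero this this)
    · intro x hx
      rcases Finset.mem_insert.1 hx with rfl | hx
      · have h0 : v x = 0 := by simp [v]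
        have hv0 : HasFDerivAt v (0 : (Fin d → ℝ) →L[ℝ] ℝ) x := by
          refine ((hu x).hasFDerivAt.mul (hu x).hasFDerivAt).congr_fderiv ?_
          simp
        refine ⟨by simp [h0], ?_⟩
        exact ((hwd x).hasFDerivAt.mul hv0).congr_fderiv (by simp [h0])
      · refine ⟨by simp [(hwX x hx).1], ?_⟩
        exact ((hwX x hx).2.mul (hvd x).hasFDerivAt).congr_fderiv (by simp [(hwX x hx).1])

theorem exists_hermite_interpolation {d : ℕ} (n : ℕ) (X : Finset (Fin d → ℝ))
    (c : (Fin d → ℝ) → ℝ) (L : (Fin d → ℝ) → (Fin d → ℝ) →L[ℝ] ℝ) :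
    ∃ p : (Fin d → ℝ) → ℝ, HasDifferentiableExtension d n p ∧ Differentiable ℝ p ∧
      ∀ x ∈ X, p x = c x ∧ HasFDerivAt p (L x) x := by
  classical
  induction X using Finset.induction_on with
  | empty => exact ⟨fun _ => 0, .const 0, differentiable_const _, by simp⟩
  | insert z X hz ih =>
    obtain ⟨p, hp, hpd, hpX⟩ := ih
    obtain ⟨w, hw, hwd, hwz, hwX⟩ := exists_vanishing_to_second_order n X z hz
    -- The correction is `w` times an affine function with value `a` and slope `l` at `z`,
    -- determined by the two interpolation conditions at `z`.
    let a : ℝ := (w z)⁻¹ * (c z - p z)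
    let l : (Fin d → ℝ) →L[ℝ] ℝ := (w z)⁻¹ • (L z - fderiv ℝ p z - a • fderiv ℝ w z)
    let u : (Fin d → ℝ) → ℝ := fun y => l y + (a - l z)
    have hu : HasDifferentiableExtension d n u :=
      (HasDifferentiableExtension.continuousLinearMap l).add (.const _)
    have hud : ∀ y, HasFDerivAt u l y := fun y => l.hasFDerivAt.add_const _
    have huz : u z = a := by simp [u]
    refine ⟨fun y => p y + w y * u y, hp.add (hw.mul hu),
      hpd.add (hwd.mul fun y => (hud y).differentiableAt), fun x hx => ?_⟩
    rcases Finset.mem_insert.1 hx with rfl | hx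
    · refine ⟨?_, ?_⟩
      · simp only [huz, a]
        field_simp
        ring
      · have h := (hpd x).hasFDerivAt.add ((hwd x).hasFDerivAt.mul (hud x))
        refine h.congr_fderiv ?_
        simp only [huz, l, smul_smul, mul_inv_cancel₀ hwz, one_smul]
        abel
    · refine ⟨by simp [(hwX x hx).1, (hpX x hx).1], ?_⟩
      exact ((hpX x hx).2.add ((hwX x hx).2.mul (hud x))).congr_fderiv
        (by simp [(hwX x hx).1])

/-! ### Joint eigenvalues of nearby tuples -/

theorem norm_entry_le_l2_opNorm {n : ℕ} (M : Matrix (Fin n) (Fin n) ℂ) (i j : Fin n) :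
    ‖M i j‖ ≤ ‖M‖ := by
  have h := Matrix.l2_opNorm_mulVec M (EuclideanSpace.single j (1 : ℂ))
  rw [PiLp.norm_single, norm_one, mul_one] at h
  refine le_trans ?_ ((PiLp.norm_apply_le _ i).trans h)
  simp

/-- Each column of a unitary matrix has an entry of modulus at least `1 / n`. -/
theorem exists_one_le_mul_norm_entry {n : ℕ} {W : Matrix (Fin n) (Fin n) ℂ}
    (hW : star W * W = 1) (j : Fin n) : ∃ i, 1 ≤ n * ‖W i j‖ := by
  have h1 : ∑ i, ‖W i j‖ ^ 2 = 1 := by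
    have h := congrFun (congrFun hW j) j
    simp only [Matrix.mul_apply, Matrix.star_apply, RCLike.star_def, Complex.conj_mul',
      Matrix.one_apply_eq] at h
    exact_mod_cast h
  have hle : ∀ i, ‖W i j‖ ≤ 1 := fun i => by
    have h2 := Finset.single_le_sum (f := fun i => ‖W i j‖ ^ 2) (fun i _ => by positivity)
      (Finset.mem_univ i)
    rw [h1] at h2
    exact (sq_le_one_iff₀ (norm_nonneg _)).1 h2
  have hn : (0 : ℝ) < n := by exact_mod_cast j.pos
  by_contra! hc
  have h3 : ∑ i, ‖W i j‖ ^ 2 < ∑ _i : Fin n, (n : ℝ)⁻¹ := by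
    refine Finset.sum_lt_sum_of_nonempty ⟨j, Finset.mem_univ j⟩ fun i _ => ?_
    have h4 : ‖W i j‖ < (n : ℝ)⁻¹ := by
      rw [← one_div, lt_div_iff₀' hn]
      exact hc i
    nlinarith [hle i, norm_nonneg (W i j)]
  rw [h1] at h3
  simp [hn.ne'] at h3

theorem norm_unitary_mul_mul_unitary {n : ℕ} {U V : Matrix (Fin n) (Fin n) ℂ}
    (hU : U ∈ Matrix.unitaryGroup (Fin n) ℂ) (hV : V ∈ Matrix.unitaryGroup (Fin n) ℂ)
    (M : Matrix (Fin n) (Fin n) ℂ) : ‖U * M * V‖ = ‖M‖ := by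
  rw [CStarRing.norm_mul_mem_unitary _ hV, CStarRing.norm_mem_unitary_mul _ hU]

/-- With `W = U* V`, the `(i, j)` entry of `U* (S r - A r) V` is `W i j * (y j r - x i r)`; the
bound follows by choosing `i` such that `W i j` is not small, the same `i` for all `r`. -/
theorem IsJointDiag.exists_eigenvalue_near {d n : ℕ} {A S : MatTuple d n}
    {U V : Matrix (Fin n) (Fin n) ℂ} {x y : Fin n → Fin d → ℝ}
    (hU : IsJointDiag A U x) (hV : IsJointDiag S V y) (j : Fin n) :
    ∃ i, ‖y j - x i‖ ≤ n * ‖S - A‖ := by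
  have hU1 := Matrix.mem_unitaryGroup_iff'.1 hU.unitary
  have hV1 := Matrix.mem_unitaryGroup_iff'.1 hV.unitary
  have hW : star (star U * V) * (star U * V) = 1 := by
    rw [star_mul, star_star, mul_assoc, ← mul_assoc U, Matrix.mem_unitaryGroup_iff.1 hU.unitary,
      one_mul, hV1]
  obtain ⟨i, hi⟩ := exists_one_le_mul_norm_entry hW j
  refine ⟨i, (pi_norm_le_iff_of_nonneg (by positivity)).2 fun r => ?_⟩
  have e : star U * (S r - A r) * V
      = (star U * V) * Matrix.diagonal (fun i => (y i r : ℂ))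
        - Matrix.diagonal (fun i => (x i r : ℂ)) * (star U * V) := by
    rw [mul_sub, sub_mul, hV.eq_conj r, hU.eq_conj r]
    simp only [mul_assoc, hV1, mul_one]
    rw [← mul_assoc (star U) U, hU1, one_mul]
  have e' := congrFun (congrFun e i) j
  rw [Matrix.sub_apply, Matrix.mul_diagonal, Matrix.diagonal_mul, mul_comm (x i r : ℂ),
    ← mul_sub, ← Complex.ofReal_sub] at e'
  have h := norm_entry_le_l2_opNorm (star U * (S r - A r) * V) i j
  rw [norm_unitary_mul_mul_unitary (Unitary.star_mem hU.unitary) hV.unitary, e', norm_mul,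
    Complex.norm_real] at h
  have h2 : ‖S r - A r‖ ≤ ‖S - A‖ := norm_le_pi_norm (S - A) r
  calc ‖y j r - x i r‖ ≤ (n * ‖(star U * V) i j‖) * ‖y j r - x i r‖ :=
        le_mul_of_one_le_left (norm_nonneg _) hi
    _ = n * (‖(star U * V) i j‖ * ‖y j r - x i r‖) := mul_assoc _ _ _
    _ ≤ n * ‖S - A‖ := by gcongr; exact h.trans h2

/-! ### Differentiability of matrix functions -/

/-- The norm of `matrixFunction g S` is the maximum of `|g|` over the joint eigenvalues of `S`, each
of which is within `O(‖S - A‖)` of some `x i`, where `g` vanishes together with its derivative. -/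
theorem hasFDerivWithinAt_zero_of_eigenvalues {d n : ℕ} {A : MatTuple d n}
    {U : Matrix (Fin n) (Fin n) ℂ} {x : Fin n → Fin d → ℝ} (hU : IsJointDiag A U x)
    {g : (Fin d → ℝ) → ℝ} (hg0 : ∀ i, g (x i) = 0)
    (hg : ∀ i, HasFDerivAt g (0 : (Fin d → ℝ) →L[ℝ] ℝ) (x i)) :
    HasFDerivWithinAt (matrixFunction g)
      (0 : MatTuple d n →L[ℝ] Matrix (Fin n) (Fin n) ℂ) (CS d n) A := by
  have hA : matrixFunction g A = 0 := by
    rw [matrixFunction_eq g hU]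
    simp [hg0]
  rw [hasFDerivWithinAt_iff_isLittleO]
  simp only [hA, sub_zero, zero_apply]
  rw [Asymptotics.isLittleO_iff]
  intro ε hε
  have hε' : 0 < ε / (n + 1) := by positivity
  have hev : ∀ i, ∃ δ > 0, ∀ y, ‖y - x i‖ < δ → ‖g y‖ ≤ ε / (n + 1) * ‖y - x i‖ := fun i => by
    have h := Asymptotics.isLittleO_iff.1 (hasFDerivAt_iff_isLittleO.1 (hg i)) hε'
    simp only [hg0, sub_zero, zero_apply] at h
    obtain ⟨δ, hδ, h⟩ := Metric.eventually_nhds_iff.1 h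
    exact ⟨δ, hδ, fun y hy => h (by rwa [dist_eq_norm])⟩
  choose δ hδ hδg using hev
  have hnear : ∀ᶠ S in nhdsWithin A (CS d n), ∀ i, n * ‖S - A‖ < δ i := by
    refine Filter.eventually_all.2 fun i => ?_
    have hc : Filter.Tendsto (fun S : MatTuple d n => n * ‖S - A‖) (nhdsWithin A (CS d n))
        (nhds (n * ‖A - A‖)) :=
      (Continuous.tendsto (by fun_prop) A).mono_left nhdsWithin_le_nhds
    rw [sub_self, norm_zero, mul_zero] at hc
    exact hc.eventually_lt_const (hδ i)
  filter_upwards [hnear, self_mem_nhdsWithin] with S hS hSCS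
  obtain ⟨V, y, hV⟩ := exists_isJointDiag hSCS
  rw [matrixFunction_eq g hV,
    norm_unitary_mul_mul_unitary hV.unitary (Unitary.star_mem hV.unitary),
    Matrix.l2_opNorm_diagonal, pi_norm_le_iff_of_nonneg (by positivity)]
  intro j
  obtain ⟨i, hi⟩ := hU.exists_eigenvalue_near hV j
  rw [Complex.norm_real]
  calc ‖g (y j)‖ ≤ ε / (n + 1) * ‖y j - x i‖ := hδg i _ (hi.trans_lt (hS i))
    _ ≤ ε / (n + 1) * ((n + 1) * ‖S - A‖) := by
        gcongr
        exact hi.trans (by gcongr; linarith)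
    _ = ε * ‖S - A‖ := by field_simp

theorem exists_hasFDerivWithinAt {d n : ℕ} {A : MatTuple d n} (hA : A ∈ CS d n)
    {f : (Fin d → ℝ) → ℝ} (hf : ∀ z ∈ jointSpectrum A, DifferentiableAt ℝ f z) :
    ∃ D : MatTuple d n →L[ℝ] Matrix (Fin n) (Fin n) ℂ,
      HasFDerivWithinAt (matrixFunction f) D (CS d n) A := by
  classical
  obtain ⟨U, x, hU⟩ := exists_isJointDiag hA
  rw [jointSpectrum_eq_range hU, Set.forall_mem_range] at hf
  obtain ⟨p, ⟨Φ, hΦ, hΦp⟩, -, hp⟩ :=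
    exists_hermite_interpolation n (Finset.univ.image x) f (fderiv ℝ f)
  replace hp : ∀ i, p (x i) = f (x i) ∧ HasFDerivAt p (fderiv ℝ f (x i)) (x i) :=
    fun i => hp _ (Finset.mem_image_of_mem x (Finset.mem_univ i))
  have hg : HasFDerivWithinAt (matrixFunction fun y => f y - p y)
      (0 : MatTuple d n →L[ℝ] Matrix (Fin n) (Fin n) ℂ) (CS d n) A := by
    refine hasFDerivWithinAt_zero_of_eigenvalues hU (fun i => by simp [(hp i).1]) fun i => ?_
    exact ((hf i).hasFDerivAt.sub (hp i).2).congr_fderiv (sub_self _)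
  have hdecomp : ∀ S ∈ CS d n,
      matrixFunction f S = matrixFunction (fun y => f y - p y) S + Φ S := fun S hS => by
    obtain ⟨V, y, hV⟩ := exists_isJointDiag hS
    rw [matrixFunction_eq _ hV, matrixFunction_eq _ hV, hΦp S V y hV, ← add_mul, ← mul_add,
      Matrix.diagonal_add]
    simp
  exact ⟨_, (hg.add (hΦ A).hasFDerivAt.hasFDerivWithinAt).congr hdecomp (hdecomp A hA)⟩

end InducedMatrixFunction

theorem theorem3p1 {d n : ℕ} {I : Set ℝ} (hI : I.OrdConnected) (hI' : I.Nontrivial)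
    {S : ℝ → MatTuple d n} (hS : ContDiffOn ℝ 1 S I) (hSCS : ∀ t ∈ I, S t ∈ CS d n)
    {Ω : Set (Fin d → ℝ)} (hΩ : IsOpen Ω) (hσ : ∀ t ∈ I, jointSpectrum (S t) ⊆ Ω)
    {f : (Fin d → ℝ) → ℝ} (hf : ContDiffOn ℝ 1 f Ω) :
    ∀ t₀ ∈ I, ∃ L : Matrix (Fin n) (Fin n) ℂ,
      HasDerivWithinAt (fun t => matrixFunction f (S t)) L I t₀ ∧
      ∀ (J : Set ℝ) (T : ℝ → MatTuple d n), J.OrdConnected → J.Nontrivial → (0 : ℝ) ∈ J →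
        ContDiffOn ℝ 1 T J → (∀ t ∈ J, T t ∈ CS d n) →
        T 0 = S t₀ → derivWithin T J 0 = derivWithin S I t₀ →
        HasDerivWithinAt (fun t => matrixFunction f (T t)) L J 0 := by
  intro t₀ ht₀
  obtain ⟨D, hD⟩ := exists_hasFDerivWithinAt (hSCS t₀ ht₀) (f := f) fun z hz =>
    (hf.differentiableOn one_ne_zero).differentiableAt (hΩ.mem_nhds (hσ t₀ ht₀ hz))
  have hS' := ((hS.differentiableOn one_ne_zero) t₀ ht₀).hasDerivWithinAt
  refine ⟨D (derivWithin S I t₀), hD.comp_hasDerivWithinAt t₀ hS' hSCS, ?_⟩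
  intro J T _ _ h0 hT hTCS hT0 hT'
  have hT1 := ((hT.differentiableOn one_ne_zero) 0 h0).hasDerivWithinAt
  rw [hT'] at hT1
  rw [← hT0] at hD
  exact hD.comp_hasDerivWithinAt 0 hT1 hTCS
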